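/- Let $(\mathcal H_i)_{i\in I}$ and $(\mathcal G_k)_{k\in K}$ be finite families of real Hilbert spaces with Hilbert direct sums $\mathcal H=\bigoplus_{i\in I}\mathcal H_i$ and $\mathcal G=\bigoplus_{k\in K}\mathcal G_k$. For a real Hilbert space $E$ and $A\colon E\to 2^E$, let $\operatorname{gra}A=\{(x,x^*)\in E\times E : x^*\in Ax\}$ and $\operatorname{zer}A=\{x\in E : 0\in Ax\}$; $A$ is maximally monotone if, for every $(x,x^*)\in E\times E$, one has $(x,x^*)\in\operatorname{gra}A$ if and only if $\langle x-y,x^*-y^*\rangle\ge 0$ for every $(y,y^*)\in\operatorname{gra}A$. An operator $T\colon E\to E$ is monotone if $\langle x-y,Tx-Ty\rangle\ge 0$ for all $x,y\in E$, and cocoercive with constant $\alpha\in\left]0,+\infty\right[$ if $\langle x-y,Tx-Ty\rangle\ge\alpha\|Tx-Ty\|^2$ for all $x,y\in E$. For every $i\in I$ and every $k\in K$, let $s_i^*\in\mathcal H_i$ and $r_k\in\mathcal G_k$, and suppose the following. - $A_i\colon\mathcal H_i\to2^{\mathcal H_i}$ is maximally monotone, $C_i\colon\mathcal H_i\to\mathcal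 H_i$ is cocoercive with constant $\alpha_i^{c}\in\left]0,+\infty\right[$, $Q_i\colon\mathcal H_i\to\mathcal H_i$ is monotone and Lipschitzian with constant $\alpha_i^{l}\in\left[0,+\infty\right[$, and $R_i\colon\mathcal H\to\mathcal H_i$. - $B_k^{m}\colon\mathcal G_k\to2^{\mathcal G_k}$ is maximally monotone, $B_k^{c}\colon\mathcal G_k\to\mathcal G_k$ is cocoercive with constant $\beta_k^{c}\in\left]0,+\infty\right[$, and $B_k^{l}\colon\mathcal G_k\to\mathcal G_k$ is monotone and Lipschitzian with constant $\beta_k^{l}\in\left[0,+\infty\right[$. - $D_k^{m}\colon\mathcal G_k\to2^{\mathcal G_k}$ is maximally monotone, $D_k^{c}\colon\mathcal G_k\to\mathcal G_k$ is cocoercive with constant $\delta_k^{c}\in\left]0,+\infty\right[$, and $D_k^{l}\colon\mathcal G_k\to\mathcal G_k$ is monotone and Lipschitzian with constant $\delta_k^{l}\in\left[0,+\infty\right[$. - $L_{ki}\colon\mathcal H_i\to\mathcal G_k$ is a bounded linear operator. - $R\colon\mathcal H\to\mathcal H\colon x\mapsto(R_ix)_{i\in I}$ is monotone and Lipschitzian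 with constant $\chi\in\left[0,+\infty\right[$. Let $X=\mathcal H\oplus\mathcal G\oplus\mathcal G\oplus\mathcal G$ (Hilbert direct sum). Define the saddle operator $S\colon X\to2^X$ by letting $S(x,y,z,v^*)$ be the product set $$\prod_{i\in I}\Big(-s_i^*+A_ix_i+C_ix_i+Q_ix_i+R_ix+\sum_{k\in K}L_{ki}^*v_k^*\Big)\times\prod_{k\in K}\big(B_k^{m}y_k+B_k^{c}y_k+B_k^{l}y_k-v_k^*\big)\times\prod_{k\in K}\big(D_k^{m}z_k+D_k^{c}z_k+D_k^{l}z_k-v_k^*\big)\times\prod_{k\in K}\Big\{r_k+y_k+z_k-\sum_{i\in I}L_{ki}x_i\Big\},$$ define $M\colon X\to2^X$ by letting $M(x,y,z,v^*)$ be $$\prod_{i\in I}\Big(-s_i^*+A_ix_i+Q_ix_i+R_ix+\sum_{k\in K}L_{ki}^*v_k^*\Big)\times\prod_{k\in K}\big(B_k^{m}y_k+B_k^{l}y_k-v_k^*\big)\times\prod_{k\in K}\big(D_k^{m}z_k+D_k^{l}z_k-v_k^*\big)\times\prod_{k\in K}\Big\{r_k+y_k+z_k-\sum_{i\in I}L_{ki}x_i\Big\},$$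 and define $C\colon X\to X$ by $$C(x,y,z,v^*)=\Big((C_ix_i)_{i\in I},(B_k^{c}y_k)_{k\in K},(D_k^{c}z_k)_{k\in K},0\Big).$$ Then the following hold. (i) $S=M+C$. (ii) $M$ is maximally monotone. (iii) Suppose that $I$ and $K$ are not both empty and set $\alpha=\min\{\alpha_i^{c},\beta_k^{c},\delta_k^{c}\}_{i\in I,k\in K}$. Then: (a) $C$ is cocoercive with constant $\alpha$ (in particular $\alpha>0$). (b) For every $(p,p^*)\in\operatorname{gra}M$ and every $q\in X$, $$\operatorname{zer}S\subset\Big\{x\in X : \langle x-p,p^*+Cq\rangle\le(4\alpha)^{-1}\|p-q\|^2\Big\}.$$ -/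

import Mathlib

open scoped Pointwise

noncomputable section

namespace SaddleForm

section Operators

variable {E : Type*} [NormedAddCommGroup E] [InnerProductSpace ℝ E]

/-- The graph of a set-valued operator `A : E → 2^E`. -/
def gra (A : E → Set E) : Set (E × E) := {p | p.2 ∈ A p.1}

/-- The set of zeros of a set-valued operator. -/
def zer (A : E → Set E) : Set E := {x | (0 : E) ∈ A x}

/-- Maximal monotonicity of a set-valued operator: `(x, x')` lies in the graph if and only if it is
monotonically related to every point of the graph. -/
def IsMaximallyMonotone (A : E → Set E) : Prop :=
  ∀ x x' : E, (x, x') ∈ gra A ↔ ∀ p ∈ gra A, 0 ≤ inner ℝ (x - p.1) (x' - p.2)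

/-- Monotonicity of a single-valued operator defined everywhere. -/
def IsMonotoneMap (T : E → E) : Prop :=
  ∀ x y : E, 0 ≤ inner ℝ (x - y) (T x - T y)

/-- Cocoercivity of a single-valued operator with constant `α ∈ ]0, +∞[`. -/
def IsCocoercive (α : ℝ) (T : E → E) : Prop :=
  0 < α ∧ ∀ x y : E, α * ‖T x - T y‖ ^ 2 ≤ inner ℝ (x - y) (T x - T y)

end Operators

universe u v w t

/-- The data and the standing assumptions of the system of monotone inclusions. The Hilbert direct
sums of the families `H` and `G` are `PiLp 2 H` and `PiLp 2 G`. -/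
structure InclusionProblem {I : Type u} {K : Type v} [Fintype I] [Fintype K]
    (H : I → Type w) [∀ i, NormedAddCommGroup (H i)] [∀ i, InnerProductSpace ℝ (H i)]
    (G : K → Type t) [∀ k, NormedAddCommGroup (G k)] [∀ k, InnerProductSpace ℝ (G k)] where
  s : ∀ i, H i
  r : ∀ k, G k
  A : ∀ i, H i → Set (H i)
  A_max : ∀ i, IsMaximallyMonotone (A i)
  C : ∀ i, H i → H i
  αc : I → ℝ
  C_coco : ∀ i, IsCocoercive (αc i) (C i)
  Q : ∀ i, H i → H i
  αl : I → NNReal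
  Q_mono : ∀ i, IsMonotoneMap (Q i)
  Q_lip : ∀ i, LipschitzWith (αl i) (Q i)
  R : ∀ i, PiLp 2 H → H i
  χ : NNReal
  R_mono : IsMonotoneMap (fun x : PiLp 2 H => (WithLp.toLp 2 (fun i => R i x) : PiLp 2 H))
  R_lip : LipschitzWith χ (fun x : PiLp 2 H => (WithLp.toLp 2 (fun i => R i x) : PiLp 2 H))
  Bm : ∀ k, G k → Set (G k)
  Bm_max : ∀ k, IsMaximallyMonotone (Bm k)
  Bc : ∀ k, G k → G k
  βc : K → ℝ
  Bc_coco : ∀ k, IsCocoercive (βc k) (Bc k)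
  Bl : ∀ k, G k → G k
  βl : K → NNReal
  Bl_mono : ∀ k, IsMonotoneMap (Bl k)
  Bl_lip : ∀ k, LipschitzWith (βl k) (Bl k)
  Dm : ∀ k, G k → Set (G k)
  Dm_max : ∀ k, IsMaximallyMonotone (Dm k)
  Dc : ∀ k, G k → G k
  δc : K → ℝ
  Dc_coco : ∀ k, IsCocoercive (δc k) (Dc k)
  Dl : ∀ k, G k → G k
  δl : K → NNReal
  Dl_mono : ∀ k, IsMonotoneMap (Dl k)
  Dl_lip : ∀ k, LipschitzWith (δl k) (Dl k)
  L : ∀ k i, H i →L[ℝ] G k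

section BigSpace

variable {I : Type u} {K : Type v} [Fintype I] [Fintype K]
variable (H : I → Type w) [∀ i, NormedAddCommGroup (H i)] [∀ i, InnerProductSpace ℝ (H i)]
variable (G : K → Type t) [∀ k, NormedAddCommGroup (G k)] [∀ k, InnerProductSpace ℝ (G k)]

/-- The Hilbert direct sum `𝓗 ⊕ 𝓖 ⊕ 𝓖 ⊕ 𝓖`. -/
abbrev BigSpace : Type (max u v w t) :=
  WithLp 2 (PiLp 2 H × WithLp 2 (PiLp 2 G × WithLp 2 (PiLp 2 G × PiLp 2 G)))

variable {H G}

/-- The point `(x, y, z, v)` of `𝓗 ⊕ 𝓖 ⊕ 𝓖 ⊕ 𝓖`. -/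
def mkBig (x : PiLp 2 H) (y z v : PiLp 2 G) : BigSpace H G :=
  WithLp.toLp 2 (x, WithLp.toLp 2 (y, WithLp.toLp 2 (z, v)))

/-- The first component `x` of a point `(x, y, z, v)`. -/
def xPart (p : BigSpace H G) : PiLp 2 H := p.fst

/-- The second component `y` of a point `(x, y, z, v)`. -/
def yPart (p : BigSpace H G) : PiLp 2 G := p.snd.fst

/-- The third component `z` of a point `(x, y, z, v)`. -/
def zPart (p : BigSpace H G) : PiLp 2 G := p.snd.snd.fst

/-- The fourth component `v` of a point `(x, y, z, v)`. -/
def vPart (p : BigSpace H G) : PiLp 2 G := p.snd.snd.snd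

/-- The product set `(⨉ i, S₁ i) × (⨉ k, S₂ k) × (⨉ k, S₃ k) × (⨉ k, S₄ k)`. -/
def box (S₁ : ∀ i, Set (H i)) (S₂ S₃ S₄ : ∀ k, Set (G k)) : Set (BigSpace H G) :=
  {p | (∀ i, xPart p i ∈ S₁ i) ∧ (∀ k, yPart p k ∈ S₂ k) ∧
    (∀ k, zPart p k ∈ S₃ k) ∧ (∀ k, vPart p k ∈ S₄ k)}

end BigSpace

namespace InclusionProblem

variable {I : Type u} {K : Type v} [Fintype I] [Fintype K]
variable {H : I → Type w} [∀ i, NormedAddCommGroup (H i)] [∀ i, InnerProductSpace ℝ (H i)]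
  [∀ i, CompleteSpace (H i)]
variable {G : K → Type t} [∀ k, NormedAddCommGroup (G k)] [∀ k, InnerProductSpace ℝ (G k)]
  [∀ k, CompleteSpace (G k)]

/-- The saddle operator. -/
def saddle (P : InclusionProblem H G) (p : BigSpace H G) : Set (BigSpace H G) :=
  box
    (fun i => {-P.s i} + P.A i (xPart p i) + {P.C i (xPart p i)} + {P.Q i (xPart p i)}
      + {P.R i (xPart p)} + {∑ k, (P.L k i).adjoint (vPart p k)})
    (fun k => P.Bm k (yPart p k) + {P.Bc k (yPart p k)} + {P.Bl k (yPart p k)} + {-vPart p k})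
    (fun k => P.Dm k (zPart p k) + {P.Dc k (zPart p k)} + {P.Dl k (zPart p k)} + {-vPart p k})
    (fun k => {P.r k + yPart p k + zPart p k - ∑ i, P.L k i (xPart p i)})

/-- The set-valued part `M` of the saddle operator. -/
def opM (P : InclusionProblem H G) (p : BigSpace H G) : Set (BigSpace H G) :=
  box
    (fun i => {-P.s i} + P.A i (xPart p i) + {P.Q i (xPart p i)}
      + {P.R i (xPart p)} + {∑ k, (P.L k i).adjoint (vPart p k)})
    (fun k => P.Bm k (yPart p k) + {P.Bl k (yPart p k)} + {-vPart p k})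
    (fun k => P.Dm k (zPart p k) + {P.Dl k (zPart p k)} + {-vPart p k})
    (fun k => {P.r k + yPart p k + zPart p k - ∑ i, P.L k i (xPart p i)})

/-- The single-valued part `C` of the saddle operator. -/
def opC (P : InclusionProblem H G) (p : BigSpace H G) : BigSpace H G :=
  mkBig
    (WithLp.toLp 2 (fun i => P.C i (xPart p i)))
    (WithLp.toLp 2 (fun k => P.Bc k (yPart p k)))
    (WithLp.toLp 2 (fun k => P.Dc k (zPart p k)))
    0

/-- The set of all the cocoercivity constants of the problem; it is finite, and it is nonempty
unless both families of spaces are empty. -/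
def cocoConstants (P : InclusionProblem H G) : Set ℝ :=
  Set.range P.αc ∪ Set.range P.βc ∪ Set.range P.δc

end InclusionProblem

end SaddleForm

end

/-!
The operator `M` is obtained from products of maximally monotone operators by successively adding
monotone Lipschitz maps: `Qᵢ - sᵢ`, `R`, `Bₖˡ`, `Dₖˡ` on the factors, and finally the bounded skew
map `(x, y, z, v) ↦ (L* v, -v, -v, y + z - L x)`.

A monotone `L`-Lipschitz perturbation `T` preserves maximality by Minty's theorem: if `(x, x')` is
monotonically related to `gra (A + T)`, solve `y + c y' = x + c (x' - T x)` with `y' ∈ A y` and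
`c = 1 / (L + 1)`; testing against `(y, y' + T y)` gives `(L + 1) ‖x - y‖² ≤ L ‖x - y‖²`.

Minty's theorem asks for a point common to the balls with diameters `[p, -p']`, `(p, p')` in the
graph. By weak compactness finitely many balls suffice. For these, minimize
`‖(y - y') / 2‖² + c` over the convex hull of the points `(p, p', ⟪p, p'⟫)`; monotonicity makes
the minimum nonnegative, and the first-order condition says that `(y - y') / 2` lies in every ball.
-/

noncomputable section

namespace SaddleForm

section ConvexMinimization

variable {V E : Type*} [NormedAddCommGroup V] [NormedSpace ℝ V] [NormedAddCommGroup E]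
  [InnerProductSpace ℝ E]

theorem two_mul_inner_sub_add_nonneg_of_isMinOn {K : Set V} (hK : Convex ℝ K) {f : V →L[ℝ] E}
    {g : V →L[ℝ] ℝ} {v w : V} (hmin : IsMinOn (fun u => ‖f u‖ ^ 2 + g u) K v) (hv : v ∈ K)
    (hw : w ∈ K) : 0 ≤ 2 * inner ℝ (f v) (f (w - v)) + g (w - v) := by
  have hderiv := (f.hasFDerivAt (x := v)).norm_sq.add g.hasFDerivAt
  simpa using hmin.localize.hasFDerivWithinAt_nonneg hderiv.hasFDerivWithinAt
    (sub_mem_posTangentConeAt_of_segment_subset (hK.segment_subset hv hw))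

end ConvexMinimization

section WeakCompactness

variable {E : Type*} [NormedAddCommGroup E] [InnerProductSpace ℝ E] [CompleteSpace E]

theorem nonempty_iInter_closedBall_of_finite {ι : Type*} (c : ι → E) (r : ι → ℝ)
    (h : ∀ u : Finset ι, (⋂ i ∈ u, Metric.closedBall (c i) (r i)).Nonempty) :
    (⋂ i, Metric.closedBall (c i) (r i)).Nonempty := by
  classical
  rcases isEmpty_or_nonempty ι with hι | ⟨⟨i₀⟩⟩
  · simp
  -- Mathlib has weak-* compactness of dual balls, hence the detour through the Riesz isomorphism.
  let φ := InnerProductSpace.toDual ℝ E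
  let t (i : ι) : Set (WeakDual ℝ E) :=
    WeakDual.toStrongDual ⁻¹' Metric.closedBall (φ (c i)) (r i)
  have mem_t (f : WeakDual ℝ E) (i : ι) :
      f ∈ t i ↔ φ.symm (WeakDual.toStrongDual f) ∈ Metric.closedBall (c i) (r i) := by
    simp only [t, Set.mem_preimage, Metric.mem_closedBall]
    rw [← φ.dist_map, φ.apply_symm_apply]
  obtain ⟨f, -, hf⟩ : (t i₀ ∩ ⋂ i, t i).Nonempty := by
    refine (WeakDual.isCompact_closedBall _ _).inter_iInter_nonempty t
      (fun i => WeakDual.isClosed_closedBall _ _) fun u => ?_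
    obtain ⟨x, hx⟩ := h (insert i₀ u)
    have hxt (i : ι) (hi : i ∈ insert i₀ u) : StrongDual.toWeakDual (φ x) ∈ t i :=
      (mem_t _ i).2 (by simpa using Set.mem_iInter₂.1 hx i hi)
    exact ⟨_, hxt i₀ (Finset.mem_insert_self _ _),
      Set.mem_iInter₂.2 fun i hi => hxt i (Finset.mem_insert_of_mem hi)⟩
  exact ⟨_, Set.mem_iInter.2 fun i => (mem_t f i).1 (Set.mem_iInter.1 hf i)⟩

end WeakCompactness

section MonotoneSet

variable {E : Type*} [NormedAddCommGroup E] [InnerProductSpace ℝ E]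

/-- Monotonicity of a subset of `E × E`, regarded as the graph of a set-valued operator. -/
def IsMonotoneSet (S : Set (E × E)) : Prop :=
  ∀ p ∈ S, ∀ q ∈ S, 0 ≤ inner ℝ (p.1 - q.1) (p.2 - q.2)

theorem mem_closedBall_iff_inner_sub_add_nonpos {x y y' : E} :
    x ∈ Metric.closedBall ((2⁻¹ : ℝ) • (y - y')) (2⁻¹ * ‖y + y'‖) ↔
      inner ℝ (x - y) (x + y') ≤ 0 := by
  have hinner : inner ℝ (x - y) (x + y') =
      ‖x - (2⁻¹ : ℝ) • (y - y')‖ ^ 2 - (2⁻¹ * ‖y + y'‖) ^ 2 := by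
    simp only [mul_pow, norm_sub_sq_real, norm_add_sq_real, norm_smul, inner_sub_left,
      inner_sub_right, inner_add_right, real_inner_smul_right, real_inner_self_eq_norm_sq,
      Real.norm_eq_abs, sq_abs]
    rw [real_inner_comm x y]
    ring
  rw [Metric.mem_closedBall, dist_eq_norm, hinner, sub_nonpos,
    sq_le_sq₀ (norm_nonneg _) (by positivity)]

theorem IsMonotoneSet.inner_le_of_mem_convexHull {S : Set (E × E)} (hS : IsMonotoneSet S)
    {y y' : E} {c : ℝ}
    (h : (y, y', c) ∈ convexHull ℝ ((fun p : E × E => (p.1, p.2, inner ℝ p.1 p.2)) '' S)) :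
    inner ℝ y y' ≤ c := by
  let B (u v : E × E × ℝ) : ℝ := u.2.2 + v.2.2 - inner ℝ u.1 v.2.1 - inner ℝ v.1 u.2.1
  -- `B` polarizes `2 (c - ⟪y, y'⟫)`, is affine in each argument and nonnegative on generators.
  have B_comm (u v) : B u v = B v u := by simp only [B]; ring
  have convex_B (u) : Convex ℝ {v | 0 ≤ B u v} := by
    rintro v hv w hw a b ha hb hab
    have B_comb : B u (a • v + b • w) = a * B u v + b * B u w := by
      simp only [B, Prod.fst_add, Prod.snd_add, Prod.smul_fst, Prod.smul_snd, smul_eq_mul,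
        inner_add_left, inner_add_right, real_inner_smul_left, real_inner_smul_right]
      linear_combination (-u.2.2) * hab
    exact B_comb.ge.trans' (add_nonneg (mul_nonneg ha hv) (mul_nonneg hb hw))
  have B_nonneg (p) (hp : p ∈ S) (q) (hq : q ∈ S) :
      0 ≤ B (p.1, p.2, inner ℝ p.1 p.2) (q.1, q.2, inner ℝ q.1 q.2) := by
    have := hS p hp q hq
    simp only [inner_sub_left, inner_sub_right] at this
    simp only [B]
    linarith
  have B_extend (u) (hu : ∀ q ∈ S, 0 ≤ B u (q.1, q.2, inner ℝ q.1 q.2)) : 0 ≤ B u (y, y', c) :=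
    convexHull_min (t := {v | 0 ≤ B u v}) (Set.image_subset_iff.2 hu) (convex_B u) h
  have B_self : 0 ≤ B (y, y', c) (y, y', c) :=
    B_extend _ fun p hp => (B_extend _ (B_nonneg p hp)).trans_eq (B_comm _ _)
  simp only [B] at B_self
  linarith

theorem IsMonotoneSet.exists_forall_inner_nonpos_of_finite {S : Set (E × E)}
    (hS : IsMonotoneSet S) (hfin : S.Finite) :
    ∃ x : E, ∀ p ∈ S, inner ℝ (x - p.1) (x + p.2) ≤ 0 := by
  rcases S.eq_empty_or_nonempty with rfl | hne
  · simp
  let f : E × E × ℝ →L[ℝ] E := (2⁻¹ : ℝ) • (.fst ℝ _ _ - .fst ℝ _ _ ∘L .snd ℝ _ _)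
  let g : E × E × ℝ →L[ℝ] ℝ := .snd ℝ _ _ ∘L .snd ℝ _ _
  obtain ⟨⟨y, y', c⟩, hyK, hmin⟩ := ((hfin.image _).isCompact_convexHull ℝ).exists_isMinOn
    ((hne.image _).convexHull (𝕜 := ℝ)) (f := fun u => ‖f u‖ ^ 2 + g u) (by fun_prop)
  set x := (2⁻¹ : ℝ) • (y - y') with hx
  have min_nonneg : 0 ≤ ‖x‖ ^ 2 + c := by
    have hpolar : ‖x‖ ^ 2 + inner ℝ y y' = ‖(2⁻¹ : ℝ) • (y + y')‖ ^ 2 := by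
      simp only [hx, norm_smul, mul_pow, norm_sub_sq_real, norm_add_sq_real, Real.norm_eq_abs,
        sq_abs]
      ring
    have := hS.inner_le_of_mem_convexHull hyK
    linarith [sq_nonneg ‖(2⁻¹ : ℝ) • (y + y')‖]
  refine ⟨x, fun p hp => ?_⟩
  have first_order : 0 ≤ 2 * inner ℝ x ((2⁻¹ : ℝ) • (p.1 - p.2) - x) + (inner ℝ p.1 p.2 - c) := by
    have := two_mul_inner_sub_add_nonneg_of_isMinOn (convex_convexHull ℝ _) hmin hyK
      (subset_convexHull ℝ _ (Set.mem_image_of_mem _ hp))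
    rwa [map_sub, map_sub] at this
  simp only [inner_sub_left, inner_sub_right, inner_add_right, real_inner_smul_right,
    real_inner_self_eq_norm_sq] at first_order ⊢
  linarith [real_inner_comm x p.1]

theorem IsMonotoneSet.exists_forall_inner_nonpos [CompleteSpace E] {S : Set (E × E)}
    (hS : IsMonotoneSet S) : ∃ x : E, ∀ p ∈ S, inner ℝ (x - p.1) (x + p.2) ≤ 0 := by
  classical
  obtain ⟨x, hx⟩ := nonempty_iInter_closedBall_of_finite
    (fun p : S => (2⁻¹ : ℝ) • (p.1.1 - p.1.2)) (fun p => 2⁻¹ * ‖p.1.1 + p.1.2‖) fun u => by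
      have hu : IsMonotoneSet (Subtype.val '' (u : Set S)) := by
        rintro _ ⟨p, -, rfl⟩ _ ⟨q, -, rfl⟩
        exact hS p p.2 q q.2
      obtain ⟨x, hx⟩ := hu.exists_forall_inner_nonpos_of_finite (u.finite_toSet.image _)
      exact ⟨x, Set.mem_iInter₂.2 fun p hp =>
        mem_closedBall_iff_inner_sub_add_nonpos.2 (hx p ⟨p, hp, rfl⟩)⟩
  exact ⟨x, fun p hp => mem_closedBall_iff_inner_sub_add_nonpos.1 (Set.mem_iInter.1 hx ⟨p, hp⟩)⟩

end MonotoneSet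

section MaximallyMonotone

theorem mem_add_singleton_iff_sub_mem {M : Type*} [AddGroup M] {s : Set M} {a b : M} :
    b ∈ s + {a} ↔ b - a ∈ s := by
  rw [Set.add_singleton, Set.image_add_right, Set.mem_preimage, sub_eq_add_neg]

variable {E F : Type*} [NormedAddCommGroup E] [InnerProductSpace ℝ E]
  [NormedAddCommGroup F] [InnerProductSpace ℝ F]

theorem IsMaximallyMonotone.inner_nonneg {A : E → Set E} (hA : IsMaximallyMonotone A)
    {x x' y y' : E} (hx : x' ∈ A x) (hy : y' ∈ A y) : 0 ≤ inner ℝ (x - y) (x' - y') :=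
  (hA _ _).1 hx (_, _) hy

/-- **Minty's theorem**. -/
theorem IsMaximallyMonotone.exists_add_smul_eq [CompleteSpace E] {A : E → Set E}
    (hA : IsMaximallyMonotone A) {c : ℝ} (hc : 0 < c) (z : E) :
    ∃ x, ∃ x' ∈ A x, x + c • x' = z := by
  have hmono : IsMonotoneSet ((fun p : E × E => (p.1 - z, c • p.2)) '' gra A) := by
    rintro _ ⟨p, hp, rfl⟩ _ ⟨q, hq, rfl⟩
    rw [sub_sub_sub_cancel_right, ← smul_sub, real_inner_smul_right]
    exact mul_nonneg hc.le (hA.inner_nonneg hp hq)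
  obtain ⟨x, hx⟩ := hmono.exists_forall_inner_nonpos
  refine ⟨x + z, -(c⁻¹ • x), (hA _ _).2 fun p hp => ?_, ?_⟩
  · have hp := hx _ (Set.mem_image_of_mem _ hp)
    have : -(c⁻¹ • x) - p.2 = -(c⁻¹ • (x + c • p.2)) := by
      rw [smul_add, inv_smul_smul₀ hc.ne', neg_add']
    rw [this, inner_neg_right, real_inner_smul_right, ← sub_sub_eq_add_sub]
    exact neg_nonneg.2 (mul_nonpos_of_nonneg_of_nonpos (inv_nonneg.2 hc.le) hp)
  · rw [smul_neg, smul_inv_smul₀ hc.ne', add_neg_cancel_comm]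

theorem IsMaximallyMonotone.add_lipschitz [CompleteSpace E] {A : E → Set E}
    (hA : IsMaximallyMonotone A) {T : E → E} (hT : IsMonotoneMap T) {L : NNReal}
    (hL : LipschitzWith L T) : IsMaximallyMonotone fun x => A x + {T x} := by
  refine fun x x' => ⟨fun hx ⟨y, y'⟩ hy => ?_, fun h => ?_⟩
  · have hAxy := hA.inner_nonneg (mem_add_singleton_iff_sub_mem.1 hx)
      (mem_add_singleton_iff_sub_mem.1 hy)
    have hsum := add_nonneg hAxy (hT x y)
    rwa [← inner_add_right, sub_sub_sub_comm, sub_add_cancel] at hsum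
  · have hL1 : (0 : ℝ) < L + 1 := by positivity
    obtain ⟨y, y', hy, hyx⟩ :=
      hA.exists_add_smul_eq (inv_pos.2 hL1) (x + (L + 1 : ℝ)⁻¹ • (x' - T x))
    have hdiff : x' - T x - y' = (L + 1 : ℝ) • (y - x) := by
      rw [← inv_smul_eq_iff₀ hL1.ne', smul_sub, sub_eq_sub_iff_add_eq_add, add_comm, ← hyx,
        add_comm]
    have htest : 0 ≤ -((L + 1) * ‖x - y‖ ^ 2) + inner ℝ (x - y) (T x - T y) := by
      have := h (y, y' + T y) (Set.add_mem_add hy rfl)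
      rwa [show x' - (y' + T y) = (x' - T x - y') + (T x - T y) by abel, hdiff, ← neg_sub x y,
        inner_add_right, smul_neg, inner_neg_right, real_inner_smul_right,
        real_inner_self_eq_norm_sq] at this
    have hLip : inner ℝ (x - y) (T x - T y) ≤ L * ‖x - y‖ ^ 2 := calc
      inner ℝ (x - y) (T x - T y) ≤ ‖x - y‖ * ‖T x - T y‖ := real_inner_le_norm _ _
      _ ≤ ‖x - y‖ * (L * ‖x - y‖) := by gcongr; exact hL.norm_sub_le x y
      _ = L * ‖x - y‖ ^ 2 := by ring
    have hxy : x = y := by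
      rw [← sub_eq_zero, ← norm_eq_zero, ← sq_eq_zero_iff]
      exact le_antisymm (by linarith) (sq_nonneg _)
    subst hxy
    rw [sub_self, smul_zero, sub_eq_zero] at hdiff
    exact mem_add_singleton_iff_sub_mem.2 (hdiff ▸ hy)

theorem isMaximallyMonotone_const (a : E) : IsMaximallyMonotone fun _ : E => ({a} : Set E) := by
  refine fun x x' => ⟨?_, fun h => ?_⟩
  · rintro rfl ⟨y, y'⟩ rfl
    simp
  · have := h (x + (x' - a), a) rfl
    rw [sub_add_cancel_left, inner_neg_left, neg_nonneg] at this
    exact sub_eq_zero.1 (real_inner_self_nonpos.1 this)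

theorem IsMaximallyMonotone.exists_inner_nonpos {A : E → Set E} (hA : IsMaximallyMonotone A)
    (x x' : E) : ∃ y, ∃ y' ∈ A y, inner ℝ (x - y) (x' - y') ≤ 0 ∧
      (inner ℝ (x - y) (x' - y') = 0 → x' ∈ A x) := by
  by_cases hx : x' ∈ A x
  · exact ⟨x, x', hx, by simp, fun _ => hx⟩
  · obtain ⟨⟨y, y'⟩, hy, hneg⟩ : ∃ p ∈ gra A, inner ℝ (x - p.1) (x' - p.2) < 0 := by
      simpa using mt (hA x x').2 hx
    exact ⟨y, y', hy, hneg.le, fun h => absurd h hneg.ne⟩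

/-- The product of the set-valued operators `A` and `B`, acting on the Hilbert direct sum. -/
def prodOp (A : E → Set E) (B : F → Set F) (p : WithLp 2 (E × F)) : Set (WithLp 2 (E × F)) :=
  {u | u.fst ∈ A p.fst ∧ u.snd ∈ B p.snd}

theorem IsMaximallyMonotone.prod {A : E → Set E} {B : F → Set F} (hA : IsMaximallyMonotone A)
    (hB : IsMaximallyMonotone B) : IsMaximallyMonotone (prodOp A B) := by
  refine fun p p' => ⟨fun hp q hq => ?_, fun h => ?_⟩
  · rw [WithLp.prod_inner_apply]
    exact add_nonneg (hA.inner_nonneg hp.1 hq.1) (hB.inner_nonneg hp.2 hq.2)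
  · obtain ⟨y, y', hy, hyle, hyeq⟩ := hA.exists_inner_nonpos p.fst p'.fst
    obtain ⟨z, z', hz, hzle, hzeq⟩ := hB.exists_inner_nonpos p.snd p'.snd
    have hsum : 0 ≤ inner ℝ (p.fst - y) (p'.fst - y') + inner ℝ (p.snd - z) (p'.snd - z') := by
      have := h (WithLp.toLp 2 (y, z), WithLp.toLp 2 (y', z')) ⟨hy, hz⟩
      rwa [WithLp.prod_inner_apply] at this
    exact ⟨hyeq (by linarith), hzeq (by linarith)⟩

variable {ι : Type*} {X : ι → Type*} [∀ i, NormedAddCommGroup (X i)]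
  [∀ i, InnerProductSpace ℝ (X i)]

/-- The product of a family of set-valued operators, acting on the Hilbert direct sum. -/
def piOp (A : ∀ i, X i → Set (X i)) (x : PiLp 2 X) : Set (PiLp 2 X) :=
  {u | ∀ i, u i ∈ A i (x i)}

theorem IsMaximallyMonotone.pi [Fintype ι] {A : ∀ i, X i → Set (X i)}
    (hA : ∀ i, IsMaximallyMonotone (A i)) : IsMaximallyMonotone (piOp A) := by
  refine fun x x' => ⟨fun hx y hy => ?_, fun h => ?_⟩
  · rw [PiLp.inner_apply]
    exact Finset.sum_nonneg fun i _ => (hA i).inner_nonneg (hx i) (hy i)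
  · choose y y' hy hle heq using fun i => (hA i).exists_inner_nonpos (x i) (x' i)
    have hsum : 0 ≤ ∑ i, inner ℝ (x i - y i) (x' i - y' i) := by
      have := h (WithLp.toLp 2 y, WithLp.toLp 2 y') hy
      rwa [PiLp.inner_apply] at this
    have hzero := (Finset.sum_eq_zero_iff_of_nonpos fun i _ => hle i).1
      (le_antisymm (Finset.sum_nonpos fun i _ => hle i) hsum)
    exact fun i => heq i (hzero i (Finset.mem_univ i))

end MaximallyMonotone

section SingleValued

variable {E F : Type*} [NormedAddCommGroup E] [InnerProductSpace ℝ E]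
  [NormedAddCommGroup F] [InnerProductSpace ℝ F]

theorem IsMonotoneMap.sub_const {T : E → E} (hT : IsMonotoneMap T) (a : E) :
    IsMonotoneMap fun x => T x - a := fun x y => by
  rw [sub_sub_sub_cancel_right]
  exact hT x y

theorem isMonotoneMap_of_inner_map_self_nonneg {T : E →L[ℝ] E} (hT : ∀ x, 0 ≤ inner ℝ x (T x)) :
    IsMonotoneMap T := fun x y => by
  rw [← map_sub]
  exact hT (x - y)

theorem IsCocoercive.mono {α β : ℝ} {T : E → E} (hT : IsCocoercive β T) (hα : 0 < α)
    (hαβ : α ≤ β) : IsCocoercive α T :=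
  ⟨hα, fun x y => (mul_le_mul_of_nonneg_right hαβ (sq_nonneg _)).trans (hT.2 x y)⟩

theorem isCocoercive_zero {α : ℝ} (hα : 0 < α) : IsCocoercive α fun _ : E => (0 : E) :=
  ⟨hα, fun x y => by simp⟩

theorem IsCocoercive.prod {α : ℝ} {S : E → E} {T : F → F} (hS : IsCocoercive α S)
    (hT : IsCocoercive α T) :
    IsCocoercive α fun p : WithLp 2 (E × F) => WithLp.toLp 2 (S p.fst, T p.snd) :=
  ⟨hS.1, fun p q => by
    rw [WithLp.prod_norm_sq_eq_of_L2, WithLp.prod_inner_apply, mul_add]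
    exact add_le_add (hS.2 p.fst q.fst) (hT.2 p.snd q.snd)⟩

theorem IsCocoercive.pi {ι : Type*} [Fintype ι] {X : ι → Type*} [∀ i, NormedAddCommGroup (X i)]
    [∀ i, InnerProductSpace ℝ (X i)] {α : ℝ} (hα : 0 < α) {T : ∀ i, X i → X i}
    (hT : ∀ i, IsCocoercive α (T i)) :
    IsCocoercive α fun x : PiLp 2 X => (WithLp.toLp 2 fun i => T i (x i) : PiLp 2 X) :=
  ⟨hα, fun x y => by
    rw [PiLp.norm_sq_eq_of_L2, PiLp.inner_apply, Finset.mul_sum]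
    exact Finset.sum_le_sum fun i _ => (hT i).2 (x i) (y i)⟩

theorem IsCocoercive.inner_sub_sub_le {α : ℝ} {T : E → E} (hT : IsCocoercive α T) (x p q : E) :
    inner ℝ (x - p) (T q - T x) ≤ (4 * α)⁻¹ * ‖p - q‖ ^ 2 := by
  obtain ⟨hα, hT⟩ := hT
  have hsplit : inner ℝ (x - p) (T q - T x) =
      inner ℝ (p - q) (T x - T q) - inner ℝ (x - q) (T x - T q) := by
    rw [← inner_sub_left, ← neg_sub (T x), inner_neg_right, ← inner_neg_left,
      sub_sub_sub_cancel_right, neg_sub]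
  have young : ‖p - q‖ * ‖T x - T q‖ ≤ (4 * α)⁻¹ * ‖p - q‖ ^ 2 + α * ‖T x - T q‖ ^ 2 := by
    have hsq := mul_nonneg (inv_nonneg.2 (by positivity : 0 ≤ 4 * α))
      (sq_nonneg (‖p - q‖ - 2 * α * ‖T x - T q‖))
    have : (4 * α)⁻¹ * (‖p - q‖ - 2 * α * ‖T x - T q‖) ^ 2 =
        (4 * α)⁻¹ * ‖p - q‖ ^ 2 + α * ‖T x - T q‖ ^ 2 - ‖p - q‖ * ‖T x - T q‖ := by
      field_simp
      ring
    linarith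
  linarith [hT x q, real_inner_le_norm (p - q) (T x - T q)]

theorem inner_sub_add_le_of_isCocoercive {A : E → Set E} (hA : IsMaximallyMonotone A) {α : ℝ}
    {T : E → E} (hT : IsCocoercive α T) {x p p' : E} (hx : x ∈ zer fun y => A y + {T y})
    (hp : p' ∈ A p) (q : E) : inner ℝ (x - p) (p' + T q) ≤ (4 * α)⁻¹ * ‖p - q‖ ^ 2 := by
  have hmono := hA.inner_nonneg (mem_add_singleton_iff_sub_mem.1 hx) hp
  have hcoco := hT.inner_sub_sub_le x p q
  have : p' + T q = T q - T x - (0 - T x - p') := by abel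
  rw [this, inner_sub_right]
  linarith

end SingleValued

section BlockOp

variable {I K : Type*} [Fintype I]
  {H : I → Type*} [∀ i, NormedAddCommGroup (H i)] [∀ i, InnerProductSpace ℝ (H i)]
  {G : K → Type*} [∀ k, NormedAddCommGroup (G k)] [∀ k, InnerProductSpace ℝ (G k)]

/-- The bounded operator between Hilbert direct sums with the operator matrix `L`. -/
def blockOp (L : ∀ k i, H i →L[ℝ] G k) : PiLp 2 H →L[ℝ] PiLp 2 G :=
  (PiLp.continuousLinearEquiv 2 ℝ G).symm ∘L
    ContinuousLinearMap.pi fun k => ∑ i, L k i ∘L PiLp.proj 2 H i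

theorem blockOp_apply (L : ∀ k i, H i →L[ℝ] G k) (x : PiLp 2 H) (k : K) :
    blockOp L x k = ∑ i, L k i (x i) := by
  simp [blockOp]

theorem adjoint_blockOp [Fintype K] [∀ i, CompleteSpace (H i)] [∀ k, CompleteSpace (G k)]
    (L : ∀ k i, H i →L[ℝ] G k) :
    (blockOp L).adjoint = blockOp fun i k => (L k i).adjoint := by
  refine ((ContinuousLinearMap.eq_adjoint_iff _ _).2 fun v x => ?_).symm
  simp only [PiLp.inner_apply, blockOp_apply, sum_inner, inner_sum,
    ContinuousLinearMap.adjoint_inner_left]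
  exact Finset.sum_comm

end BlockOp

section Box

variable {I K : Type*} {H : I → Type*} [∀ i, NormedAddCommGroup (H i)]
  {G : K → Type*} [∀ k, NormedAddCommGroup (G k)]

theorem box_add_singleton_mkBig (S₁ : ∀ i, Set (H i)) (S₂ S₃ S₄ : ∀ k, Set (G k)) (x : PiLp 2 H)
    (y z v : PiLp 2 G) :
    box S₁ S₂ S₃ S₄ + {mkBig x y z v} =
      box (fun i => S₁ i + {x i}) (fun k => S₂ k + {y k}) (fun k => S₃ k + {z k})
        (fun k => S₄ k + {v k}) := by
  ext p
  simp only [box, mem_add_singleton_iff_sub_mem]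
  rfl

end Box

namespace InclusionProblem

variable {I K : Type*} [Fintype I] [Fintype K]
  {H : I → Type*} [∀ i, NormedAddCommGroup (H i)] [∀ i, InnerProductSpace ℝ (H i)]
  {G : K → Type*} [∀ k, NormedAddCommGroup (G k)] [∀ k, InnerProductSpace ℝ (G k)]
  (P : InclusionProblem H G)

theorem pos_of_mem_cocoConstants {α : ℝ} (hα : α ∈ P.cocoConstants) : 0 < α := by
  rcases hα with (⟨i, rfl⟩ | ⟨k, rfl⟩) | ⟨k, rfl⟩
  exacts [(P.C_coco i).1, (P.Bc_coco k).1, (P.Dc_coco k).1]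

theorem isCocoercive_opC {α : ℝ} (hα : 0 < α) (hle : α ∈ lowerBounds P.cocoConstants) :
    IsCocoercive α P.opC := by
  have hC (i : I) : IsCocoercive α (P.C i) := (P.C_coco i).mono hα (hle (.inl (.inl ⟨i, rfl⟩)))
  have hBc (k : K) : IsCocoercive α (P.Bc k) := (P.Bc_coco k).mono hα (hle (.inl (.inr ⟨k, rfl⟩)))
  have hDc (k : K) : IsCocoercive α (P.Dc k) := (P.Dc_coco k).mono hα (hle (.inr ⟨k, rfl⟩))
  have hprod := (IsCocoercive.pi hα hC).prod <| (IsCocoercive.pi hα hBc).prod <|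
    (IsCocoercive.pi hα hDc).prod (isCocoercive_zero (E := PiLp 2 G) hα)
  exact hprod

variable [∀ i, CompleteSpace (H i)] [∀ k, CompleteSpace (G k)]

/-- The bounded skew part `(x, y, z, v) ↦ (L* v, -v, -v, y + z - L x)` of the saddle operator. -/
def skew : BigSpace H G →L[ℝ] BigSpace H G where
  toFun p := mkBig ((blockOp P.L).adjoint (vPart p)) (-vPart p) (-vPart p)
    (yPart p + zPart p - blockOp P.L (xPart p))
  map_add' p q := by
    simp only [mkBig, xPart, yPart, zPart, vPart, WithLp.add_fst, WithLp.add_snd, map_add,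
      neg_add, ← WithLp.toLp_add, Prod.mk_add_mk]
    rw [add_add_add_comm, add_sub_add_comm]
  map_smul' c p := by
    simp only [mkBig, xPart, yPart, zPart, vPart, WithLp.smul_fst, WithLp.smul_snd, map_smul,
      smul_neg, ← WithLp.toLp_smul, Prod.smul_mk, smul_add, smul_sub, RingHom.id_apply]
  cont := by unfold mkBig xPart yPart zPart vPart; fun_prop

theorem inner_skew_self (p : BigSpace H G) : inner ℝ p (P.skew p) = 0 :=
  calc
    inner ℝ p (P.skew p) = inner ℝ (xPart p) ((blockOp P.L).adjoint (vPart p)) +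
        (inner ℝ (yPart p) (-vPart p) + (inner ℝ (zPart p) (-vPart p) +
          inner ℝ (vPart p) (yPart p + zPart p - blockOp P.L (xPart p)))) := by
      simp only [WithLp.prod_inner_apply]
      rfl
    _ = 0 := by
      rw [ContinuousLinearMap.adjoint_inner_right, inner_neg_right, inner_neg_right,
        inner_sub_right, inner_add_right, real_inner_comm (vPart p) (yPart p),
        real_inner_comm (vPart p) (zPart p), real_inner_comm (vPart p)]
      ring

/-- The part of `opM` without couplings between the components `x`, `y`, `z` and `v`. -/
def decoupled : BigSpace H G → Set (BigSpace H G) :=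
  prodOp
    (fun x => piOp (fun i a => P.A i a + {P.Q i a - P.s i}) x + {WithLp.toLp 2 fun i => P.R i x})
    (prodOp (piOp fun k b => P.Bm k b + {P.Bl k b})
      (prodOp (piOp fun k d => P.Dm k d + {P.Dl k d}) fun _ => {WithLp.toLp 2 P.r}))

theorem isMaximallyMonotone_decoupled : IsMaximallyMonotone P.decoupled :=
  .prod (.add_lipschitz
      (.pi fun i => (P.A_max i).add_lipschitz ((P.Q_mono i).sub_const _)
        ((P.Q_lip i).sub (LipschitzWith.const _)))
      P.R_mono P.R_lip) <|
    .prod (.pi fun k => (P.Bm_max k).add_lipschitz (P.Bl_mono k) (P.Bl_lip k)) <|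
      .prod (.pi fun k => (P.Dm_max k).add_lipschitz (P.Dl_mono k) (P.Dl_lip k))
        (isMaximallyMonotone_const _)

theorem opM_eq_decoupled_add_skew : P.opM = fun p => P.decoupled p + {P.skew p} := by
  ext p p'
  rw [mem_add_singleton_iff_sub_mem]
  refine and_congr ?_ (and_congr (forall_congr' fun k => mem_add_singleton_iff_sub_mem)
    (and_congr (forall_congr' fun k => mem_add_singleton_iff_sub_mem) ?_))
  · change _ ↔ xPart p' - (blockOp P.L).adjoint (vPart p) ∈ piOp _ (xPart p) + {_}
    rw [mem_add_singleton_iff_sub_mem, adjoint_blockOp]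
    refine forall_congr' fun i => ?_
    simp only [PiLp.sub_apply, blockOp_apply]
    rw [← mem_add_singleton_iff_sub_mem, ← mem_add_singleton_iff_sub_mem, sub_eq_add_neg,
      ← Set.singleton_add_singleton]
    exact iff_of_eq (congrArg (_ ∈ ·) (by ac_rfl))
  · change (∀ k, vPart p' k = _) ↔
      vPart p' - (yPart p + zPart p - blockOp P.L (xPart p)) = WithLp.toLp 2 P.r
    simp only [sub_eq_iff_eq_add, PiLp.ext_iff, PiLp.add_apply, PiLp.sub_apply, blockOp_apply,
      add_sub_assoc, add_assoc]

theorem isMaximallyMonotone_opM : IsMaximallyMonotone P.opM := by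
  rw [opM_eq_decoupled_add_skew]
  exact P.isMaximallyMonotone_decoupled.add_lipschitz
    (isMonotoneMap_of_inner_map_self_nonneg fun p => (P.inner_skew_self p).ge) P.skew.lipschitz

theorem saddle_eq_opM_add_opC : P.saddle = fun p => P.opM p + {P.opC p} := by
  funext p
  simp only [saddle, opM, opC, box_add_singleton_mkBig, PiLp.zero_apply, Set.singleton_zero,
    add_zero]
  congr! 2 <;> ac_rfl

end InclusionProblem

end SaddleForm

end

theorem proposition2 {I : Type*} {K : Type*} [Fintype I] [Fintype K]
    (H : I → Type*) [∀ i, NormedAddCommGroup (H i)] [∀ i, InnerProductSpace ℝ (H i)]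
    [∀ i, CompleteSpace (H i)]
    (G : K → Type*) [∀ k, NormedAddCommGroup (G k)] [∀ k, InnerProductSpace ℝ (G k)]
    [∀ k, CompleteSpace (G k)]
    (P : SaddleForm.InclusionProblem H G) :
    (∀ x : SaddleForm.BigSpace H G, P.saddle x = P.opM x + {P.opC x}) ∧
    SaddleForm.IsMaximallyMonotone P.opM ∧
    ∀ α : ℝ, IsLeast P.cocoConstants α →
      SaddleForm.IsCocoercive α P.opC ∧
      ∀ p p' : SaddleForm.BigSpace H G, (p, p') ∈ SaddleForm.gra P.opM →
        ∀ q : SaddleForm.BigSpace H G,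
          SaddleForm.zer P.saddle ⊆
            {x : SaddleForm.BigSpace H G |
              inner ℝ (x - p) (p' + P.opC q) ≤ (4 * α)⁻¹ * ‖p - q‖ ^ 2} := by
  refine ⟨congrFun P.saddle_eq_opM_add_opC, P.isMaximallyMonotone_opM, fun α hα => ?_⟩
  have hC := P.isCocoercive_opC (P.pos_of_mem_cocoConstants hα.1) hα.2
  refine ⟨hC, fun p p' hp q x hx => ?_⟩
  rw [P.saddle_eq_opM_add_opC] at hx
  exact SaddleForm.inner_sub_add_le_of_isCocoercive P.isMaximallyMonotone_opM hC hx hp q
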